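/- Let $M$ be a unital (complex) $C^*$-algebra with norm $\|\cdot\|$, and let $\mathcal I_0\subseteq M$ be a two-sided ideal equipped with a norm $\|\cdot\|_{\mathcal I}$ of its own such that $\|ABC\|_{\mathcal I}\le\|A\|\,\|B\|_{\mathcal I}\,\|C\|$ for all $A,C\in M$ and $B\in\mathcal I_0$. (The ideal $\mathcal I_0$ need not be closed in $M$, nor complete for $\|\cdot\|_{\mathcal I}$.) Let $\mathcal I$ be the completion of $\mathcal I_0$ with respect to $\|\cdot\|_{\mathcal I}$, with the extended norm again denoted by $\|\cdot\|_{\mathcal I}$, and regard $\mathcal I_0$ as the set $M\cap\mathcal I$ of elements of $M$ that lie in $\mathcal I$. Let $\exp:M\to M$, $\exp(X)=e^X$, be the exponential map and let $d\exp_X:M\to M$ be its differential at $X$. If $X,Y\in\mathcal I_0$ are self-adjoint, then $e^{-X/2}\,d\exp_X(Y)\,e^{-X/2}$ belongs to $\mathcal I_0$ and $$\bigl\|e^{-X/2}\,d\exp_X(Y)\,e^{-X/2}\bigr\|_{\mathcal I}\ \ge\ \|Y\|_{\mathcal I}.$$ -/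

import Mathlib

/-- A normed ideal in a (unital) C⋆-algebra `M` with a unitarily invariant norm: a two-sided ideal
`I₀` of `M` (not assumed closed or complete), with a norm of its own, such that
`‖x y z‖_I ≤ ‖x‖ ‖y‖_I ‖z‖` for `x, z ∈ M` and `y ∈ I₀`. -/
structure NormedIdeal (M : Type*) [CStarAlgebra M] extends Submodule ℂ M where
  mul_mem_left : ∀ (a : M) {y : M}, y ∈ toSubmodule → a * y ∈ toSubmodule
  mul_mem_right : ∀ (a : M) {y : M}, y ∈ toSubmodule → y * a ∈ toSubmodule
  /-- the norm of the ideal -/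
  nrm : Seminorm ℂ toSubmodule
  eq_zero_of_nrm : ∀ y : toSubmodule, nrm y = 0 → y = 0
  nrm_mul_mul_le : ∀ (x z : M) (y : toSubmodule),
    nrm ⟨x * (y : M) * z, mul_mem_right z (mul_mem_left x y.2)⟩ ≤ ‖x‖ * nrm y * ‖z‖

namespace NormedIdeal

/-- The vector space `I₀`, as a type that carries the norm of the ideal
(and not the norm inherited from `M`). -/
def Elem {M : Type*} [CStarAlgebra M] (I : NormedIdeal M) : Type _ := I.toSubmodule

noncomputable instance {M : Type*} [CStarAlgebra M] (I : NormedIdeal M) : AddCommGroup I.Elem :=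
  inferInstanceAs (AddCommGroup I.toSubmodule)

noncomputable instance {M : Type*} [CStarAlgebra M] (I : NormedIdeal M) : Module ℂ I.Elem :=
  inferInstanceAs (Module ℂ I.toSubmodule)

theorem normedCore {M : Type*} [CStarAlgebra M] (I : NormedIdeal M) :
    @NormedSpace.Core ℂ I.Elem _ _ _ ⟨fun y => I.nrm y⟩ :=
  letI : Norm I.Elem := ⟨fun y => I.nrm y⟩
  { norm_nonneg := fun y => apply_nonneg I.nrm y
    norm_smul := fun c y => map_smul_eq_mul I.nrm c y
    norm_triangle := fun x y => map_add_le_add I.nrm x y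
    norm_eq_zero_iff := fun y =>
      ⟨fun h => I.eq_zero_of_nrm y h, fun h => by subst h; exact map_zero I.nrm⟩ }

noncomputable instance {M : Type*} [CStarAlgebra M] (I : NormedIdeal M) :
    NormedAddCommGroup I.Elem :=
  letI : Norm I.Elem := ⟨fun y => I.nrm y⟩
  NormedAddCommGroup.ofCore I.normedCore

noncomputable instance {M : Type*} [CStarAlgebra M] (I : NormedIdeal M) : NormedSpace ℂ I.Elem :=
  letI : Norm I.Elem := ⟨fun y => I.nrm y⟩
  NormedSpace.ofCore I.normedCore

/-- The Banach space obtained by completing `I₀` in the norm of the ideal. -/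
abbrev Completed {M : Type*} [CStarAlgebra M] (I : NormedIdeal M) : Type _ :=
  UniformSpace.Completion I.Elem

/-- An element of `M` lying in the ideal `I₀`, as an element of the completed ideal. -/
noncomputable def emb {M : Type*} [CStarAlgebra M] (I : NormedIdeal M) (y : M)
    (hy : y ∈ I.toSubmodule) : I.Completed :=
  let y₀ : I.Elem := (⟨y, hy⟩ : I.toSubmodule)
  (y₀ : UniformSpace.Completion I.Elem)

theorem norm_emb {M : Type*} [CStarAlgebra M] (I : NormedIdeal M) (y : M)
    (hy : y ∈ I.toSubmodule) : ‖I.emb y hy‖ = I.nrm ⟨y, hy⟩ :=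
  UniformSpace.Completion.norm_coe (E := I.Elem) (⟨y, hy⟩ : I.toSubmodule)

end NormedIdeal

/-- The differential at `X` of the exponential map `exp : M → M`. -/
noncomputable def dexp {M : Type*} [CStarAlgebra M] (X : M) : M →L[ℂ] M :=
  fderiv ℂ (NormedSpace.exp : M → M) X

theorem hasFDerivAt_dexp {M : Type*} [CStarAlgebra M] (X : M) :
    HasFDerivAt (NormedSpace.exp : M → M) (dexp X) X :=
  (NormedSpace.exp_analytic (𝕂 := ℂ) X).differentiableAt.hasFDerivAt

/-! Put `H = X / 2`. Duhamel's formula turns the conjugated differential into `∫₀¹ e^{(2s-1) ad H} Y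
ds`, that is, `sinhc (ad H) Y` with `sinhc z = sinh z / z`. Its approximants `((1 + z/n)^n - (1 -
z/n)^n) / (2z)` are polynomials with value `1` at `0` and purely imaginary roots, hence products of
factors `1 + i c z` with `c` real. Since `H` is self-adjoint, `ad H` is Hermitian for the ideal
norm, so every `1 + i c ad H` is expansive, and so is every approximant (`Seminorm.le_aeval_apply`,
`nrm_le_add_smul_ad`).

The ideal is not complete, so the limit is taken in `M`. Approximants and limit both have the form
`1 + z Q(z)`; the tails `Q_n (ad H) Y` converge in `M`, and because `H` lies in the ideal, the
remaining commutator with `H` carries convergence in `M` to convergence in the ideal norm. -/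

/-! ### Expansive operators and polynomials with imaginary roots -/

open Polynomial in
/-- A polynomial with constant term `1` and purely imaginary roots, evaluated at an operator `T`
such that all `1 + i c T` (`c` real) are expansive, is expansive. -/
theorem Seminorm.le_aeval_apply {V : Type*} [AddCommGroup V] [Module ℂ V] (q : Seminorm ℂ V)
    (T : Module.End ℂ V) (hT : ∀ (c : ℝ) (y : V), q y ≤ q (y + (c * Complex.I : ℂ) • T y))
    (p : ℂ[X]) (h0 : p.eval 0 = 1) (hroots : ∀ z : ℂ, p.eval z = 0 → z.re = 0) (y : V) :
    q y ≤ q (aeval T p y) := by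
  induction hn : p.natDegree generalizing p with
  | zero =>
    rw [natDegree_eq_zero] at hn
    obtain ⟨c, rfl⟩ := hn
    have : c = 1 := by simpa using h0
    simp [this]
  | succ n ih =>
    have hdeg : p.degree ≠ 0 := by
      intro h
      rw [natDegree_eq_zero_iff_degree_le_zero.mpr h.le] at hn
      omega
    obtain ⟨r, hr⟩ := IsAlgClosed.exists_root p hdeg
    have hr0 : r ≠ 0 := by
      rintro rfl
      rw [IsRoot, h0] at hr
      exact one_ne_zero hr
    obtain ⟨s, rfl⟩ := dvd_iff_isRoot.mpr hr
    have hs0 : s.eval 0 = -r⁻¹ := by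
      simp only [eval_mul, eval_sub, eval_X, eval_C, zero_sub] at h0
      field_simp
      linear_combination -h0
    have hsne : s ≠ 0 := by
      rintro rfl
      simp at h0
    have ihs := ih (C (-r) * s) (by simp [hs0, hr0])
      (fun z hz => hroots z (by
        have : s.eval z = 0 := by simpa [hr0] using hz
        simp [this]))
      (by
        rw [natDegree_C_mul (neg_ne_zero.mpr hr0)]
        rw [natDegree_mul (X_sub_C_ne_zero r) hsne, natDegree_X_sub_C] at hn
        omega)
    refine ihs.trans ?_
    have hrI : r = r.im * Complex.I := by
      apply Complex.ext <;> simp [hroots r hr]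
    have him : r.im ≠ 0 := fun h => hr0 (by rw [hrI, h]; simp)
    have hc : ((r.im⁻¹ : ℝ) * Complex.I : ℂ) = -r⁻¹ := by
      rw [hrI]
      have : (r.im : ℂ) ≠ 0 := by exact_mod_cast him
      have hI := Complex.I_ne_zero
      push_cast
      simp [mul_comm]
    -- The linear factor is rescaled to `1 - X / r`, of the form `1 + i c X`; the scalar `-r` goes
    -- to the cofactor, which thus regains constant term `1`.
    have hfac : (X - C r) * s = (1 + C (-r⁻¹) * X) * (C (-r) * s) := by
      have : C r⁻¹ * C r = (1 : ℂ[X]) := by rw [← C_mul, inv_mul_cancel₀ hr0, C_1]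
      simp only [C_neg]
      linear_combination (-X * s) * this
    have := hT r.im⁻¹ (aeval T (C (-r) * s) y)
    rw [hc] at this
    refine this.trans (le_of_eq ?_)
    rw [hfac]
    generalize C (-r) * s = g
    simp

/-! ### Commutators with self-adjoint elements are Hermitian on the ideal -/

/-- `1 + i h X` has norm at most `√(1 + h² ‖X‖²)` for self-adjoint `X`. -/
theorem norm_one_add_I_smul_sq_le {M : Type*} [CStarAlgebra M] {X : M} (hX : IsSelfAdjoint X)
    (h : ℝ) : ‖1 + (h * Complex.I : ℂ) • X‖ ^ 2 ≤ 1 + h ^ 2 * ‖X‖ ^ 2 := by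
  have h1 : ‖(1 : M)‖ ≤ 1 := by
    cases subsingleton_or_nontrivial M
    · rw [Subsingleton.elim (1 : M) 0]; simp
    · simp
  have hstar : star (1 + (h * Complex.I : ℂ) • X) * (1 + (h * Complex.I : ℂ) • X) =
      1 + ((h ^ 2 : ℝ) : ℂ) • (X * X) := by
    have hI : (h * Complex.I : ℂ) * (h * Complex.I) = -((h ^ 2 : ℝ) : ℂ) := by
      push_cast
      linear_combination (h : ℂ) ^ 2 * Complex.I_mul_I
    simp only [star_add, star_one, star_smul, hX.star_eq]
    have : star (h * Complex.I : ℂ) = -(h * Complex.I) := by simp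
    rw [this]
    simp only [add_mul, mul_add, one_mul, mul_one, smul_mul_smul_comm, neg_smul, neg_mul, hI]
    module
  rw [sq, ← CStarRing.norm_star_mul_self, hstar]
  refine (norm_add_le _ _).trans (add_le_add h1 ?_)
  rw [norm_smul, Complex.norm_real, Real.norm_of_nonneg (sq_nonneg h), sq ‖X‖]
  gcongr
  exact norm_mul_le _ _

namespace NormedIdeal

variable {M : Type*} [CStarAlgebra M] (I : NormedIdeal M)

/-- The commutator with `X` as an operator on the ideal. -/
def ad (X : M) : Module.End ℂ I.toSubmodule where
  toFun y := ⟨X * y - y * X,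
    sub_mem (I.mul_mem_left X y.2) (I.mul_mem_right X y.2)⟩
  map_add' y z := by ext; simp [mul_add, add_mul]; abel
  map_smul' c y := by ext; simp [smul_sub]

@[simp]
theorem coe_ad_apply (X : M) (y : I.toSubmodule) : (I.ad X y : M) = X * y - y * X := rfl

theorem nrm_mul_mul_le' (x z : M) (y w : I.toSubmodule) (hw : (w : M) = x * y * z) :
    I.nrm w ≤ ‖x‖ * I.nrm y * ‖z‖ := by
  have : w = ⟨x * (y : M) * z, I.mul_mem_right z (I.mul_mem_left x y.2)⟩ := Subtype.ext hw
  rw [this]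
  exact I.nrm_mul_mul_le x z y

/-- The product `(1 + ihX) y (1 - ihX)` differs from `y + ih[X, y]` only by `h² X y X`, and its
outer factors have norm at most `√(1 + h²‖X‖²)`. What matters is that the excess over `1` is of
second order in `h`. -/
theorem nrm_add_smul_ad_le {X : M} (hX : IsSelfAdjoint X) (h : ℝ) (y : I.toSubmodule) :
    I.nrm (y + (h * Complex.I : ℂ) • I.ad X y) ≤ (1 + 2 * (h ^ 2 * ‖X‖ ^ 2)) * I.nrm y := by
  have hy := apply_nonneg I.nrm y
  set a : M := 1 + (h * Complex.I : ℂ) • X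
  set b : M := 1 + ((-h : ℝ) * Complex.I : ℂ) • X
  let u : I.toSubmodule := ⟨a * y * b, I.mul_mem_right b (I.mul_mem_left a y.2)⟩
  let v : I.toSubmodule := ⟨X * y * X, I.mul_mem_right X (I.mul_mem_left X y.2)⟩
  have hu : I.nrm u ≤ (1 + h ^ 2 * ‖X‖ ^ 2) * I.nrm y := by
    refine (I.nrm_mul_mul_le a b y).trans ?_
    have ha := norm_one_add_I_smul_sq_le hX h
    have hb := norm_one_add_I_smul_sq_le hX (-h)
    have hab : ‖a‖ * ‖b‖ ≤ 1 + h ^ 2 * ‖X‖ ^ 2 := by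
      nlinarith [sq_nonneg (‖a‖ - ‖b‖)]
    calc ‖a‖ * I.nrm y * ‖b‖ = ‖a‖ * ‖b‖ * I.nrm y := by ring
      _ ≤ _ := by gcongr
  have hv : I.nrm v ≤ ‖X‖ ^ 2 * I.nrm y :=
    (I.nrm_mul_mul_le X X y).trans (le_of_eq (by ring))
  have huv : y + (h * Complex.I : ℂ) • I.ad X y = u - ((h ^ 2 : ℝ) : ℂ) • v := by
    ext
    have hI : (h * Complex.I : ℂ) * (h * Complex.I) = -((h ^ 2 : ℝ) : ℂ) := by
      push_cast
      linear_combination (h : ℂ) ^ 2 * Complex.I_mul_I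
    simp only [u, v, a, b, Submodule.coe_add, Submodule.coe_smul, coe_ad_apply,
      AddSubgroupClass.coe_sub, Complex.ofReal_neg, neg_mul, neg_smul, add_mul, mul_add, one_mul,
      mul_one, mul_neg, hI, smul_mul_assoc, mul_smul_comm, smul_smul, smul_add,
      smul_sub]
    abel
  rw [huv]
  calc I.nrm (u - ((h ^ 2 : ℝ) : ℂ) • v) ≤ I.nrm u + I.nrm (((h ^ 2 : ℝ) : ℂ) • v) :=
        map_sub_le_add _ _ _
    _ = I.nrm u + h ^ 2 * I.nrm v := by
        rw [map_smul_eq_mul, Complex.norm_real, Real.norm_of_nonneg (sq_nonneg h)]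
    _ ≤ (1 + h ^ 2 * ‖X‖ ^ 2) * I.nrm y + h ^ 2 * (‖X‖ ^ 2 * I.nrm y) := by gcongr
    _ = _ := by ring

/-- The operators `1 + i c ad X` (`c` real, `X` self-adjoint) are expansive on the ideal. -/
theorem nrm_le_add_smul_ad {X : M} (hX : IsSelfAdjoint X) (c : ℝ) (y : I.toSubmodule) :
    I.nrm y ≤ I.nrm (y + (c * Complex.I : ℂ) • I.ad X y) := by
  have hy := apply_nonneg I.nrm y
  set w := y + (c * Complex.I : ℂ) • I.ad X y with hw
  set K := 2 * (c ^ 2 * ‖X‖ ^ 2) * I.nrm y with hK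
  have key : ∀ ε : ℝ, 0 < ε → I.nrm y ≤ I.nrm w + ε * K := by
    intro ε hε
    -- With `h = -εc` the first-order terms cancel in `(1 + ε) y = (y - iεc ad X y) + ε w`; dividing
    -- by `ε` leaves an error `O(ε)`.
    have h1 := I.nrm_add_smul_ad_le hX (-(ε * c)) y
    have h2 : ((1 + ε : ℝ) : ℂ) • y =
        (y + ((-(ε * c) : ℝ) * Complex.I : ℂ) • I.ad X y) + (ε : ℂ) • w := by
      rw [hw]
      push_cast
      module
    have h3 : (1 + ε) * I.nrm y ≤
        (1 + 2 * ((-(ε * c)) ^ 2 * ‖X‖ ^ 2)) * I.nrm y + ε * I.nrm w := by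
      calc (1 + ε) * I.nrm y = I.nrm (((1 + ε : ℝ) : ℂ) • y) := by
            rw [map_smul_eq_mul, Complex.norm_real, Real.norm_of_nonneg (by positivity)]
        _ ≤ I.nrm (y + ((-(ε * c) : ℝ) * Complex.I : ℂ) • I.ad X y) + I.nrm ((ε : ℂ) • w) := by
            rw [h2]; exact map_add_le_add _ _ _
        _ ≤ _ := by
            rw [map_smul_eq_mul I.nrm (ε : ℂ), Complex.norm_real, Real.norm_of_nonneg hε.le]
            gcongr
    refine le_of_mul_le_mul_left ?_ hε
    rw [hK]
    linear_combination h3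
  have hlim : Filter.Tendsto (fun ε : ℝ => I.nrm w + ε * K) (nhdsWithin 0 (Set.Ioi 0))
      (nhds (I.nrm w + 0 * K)) :=
    ((continuous_const.add (continuous_id.mul continuous_const)).tendsto 0).mono_left
      nhdsWithin_le_nhds
  rw [zero_mul, add_zero] at hlim
  exact ge_of_tendsto hlim (by filter_upwards [self_mem_nhdsWithin] with ε hε using key ε hε)

end NormedIdeal

/-! ### Polynomial approximants of `sinh z / z` -/

/-- `(1 + (-1) ^ j) / 2`, the indicator of the even numbers. -/
noncomputable def evenCoeff (j : ℕ) : ℂ := (1 + (-1) ^ j) / 2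

theorem norm_evenCoeff_le (j : ℕ) : ‖evenCoeff j‖ ≤ 1 := by
  rcases neg_one_pow_eq_or ℂ j with h | h <;> simp [evenCoeff, h]

open Polynomial in
/-- The polynomial `Q` such that `1 + z Q(z) = ((1 + z / n) ^ n - (1 - z / n) ^ n) / (2 z)`. -/
noncomputable def sinhcTail (n : ℕ) : ℂ[X] :=
  ∑ j ∈ Finset.range (n - 1), C (evenCoeff (j + 1) * (n.choose (j + 2) / n ^ (j + 2))) * X ^ j

open Polynomial in
theorem two_mul_mul_eval_sinhcTail {n : ℕ} (hn : n ≠ 0) (z : ℂ) :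
    2 * z * (1 + z * (sinhcTail n).eval z) = (1 + z / n) ^ n - (1 - z / n) ^ n := by
  obtain ⟨m, rfl⟩ := Nat.exists_eq_succ_of_ne_zero hn
  have hm : ((m + 1 : ℕ) : ℂ) ≠ 0 := by exact_mod_cast hn
  have hb : ∀ w : ℂ, (1 + w / (m + 1 : ℕ)) ^ (m + 1) =
      ∑ j ∈ Finset.range (m + 2), w ^ j * ((m + 1).choose j / ((m + 1 : ℕ) : ℂ) ^ j) := by
    intro w
    rw [add_comm 1, add_pow]
    refine Finset.sum_congr rfl fun j _ => ?_
    rw [one_pow, mul_one, div_pow]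
    ring
  have hb' := hb (-z)
  rw [neg_div, ← sub_eq_add_neg] at hb'
  rw [Nat.succ_eq_add_one, hb z, hb', ← Finset.sum_sub_distrib, Finset.sum_range_succ',
    Finset.sum_range_succ', sinhcTail, eval_finsetSum, Nat.add_sub_cancel]
  simp only [eval_mul, eval_C, eval_pow, eval_X, Finset.mul_sum, mul_add, mul_one]
  simp only [pow_zero, zero_add, pow_one, Nat.choose_one_right, div_self hm]
  have : ∀ j ∈ Finset.range m, z ^ (j + 1 + 1) * (((m + 1).choose (j + 1 + 1) : ℂ) /
      ((m + 1 : ℕ) : ℂ) ^ (j + 1 + 1)) - (-z) ^ (j + 1 + 1) *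
      (((m + 1).choose (j + 1 + 1) : ℂ) / ((m + 1 : ℕ) : ℂ) ^ (j + 1 + 1)) =
      2 * z * (z * (evenCoeff (j + 1) * (((m + 1).choose (j + 2) : ℂ) /
      ((m + 1 : ℕ) : ℂ) ^ (j + 2)) * z ^ j)) := by
    intro j _
    rw [evenCoeff, neg_pow z]
    ring
  rw [Finset.sum_congr rfl this]
  ring

-- At a root, `|1 + z/n| = |1 - z/n|`, so `z/n` is equidistant from `-1` and `1`.
open Polynomial in
theorem re_eq_zero_of_eval_sinhcTail {n : ℕ} (hn : n ≠ 0) (z : ℂ)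
    (hz : (1 + X * sinhcTail n).eval z = 0) : z.re = 0 := by
  have h := two_mul_mul_eval_sinhcTail hn z
  have hz' : 1 + z * (sinhcTail n).eval z = 0 := by simpa using hz
  rw [hz', mul_zero] at h
  have hpow : ‖1 + z / n‖ ^ n = ‖1 - z / n‖ ^ n := by
    rw [← norm_pow, ← norm_pow, sub_eq_zero.mp h.symm]
  have hnorm := (pow_left_inj₀ (norm_nonneg _) (norm_nonneg _) hn).mp hpow
  have hsq : Complex.normSq (1 + z / n) = Complex.normSq (1 - z / n) := by
    rw [Complex.normSq_eq_norm_sq, Complex.normSq_eq_norm_sq, hnorm]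
  have hre : (z / n).re = 0 := by
    simp only [Complex.normSq_apply, Complex.add_re, Complex.sub_re, Complex.one_re,
      Complex.add_im, Complex.sub_im, Complex.one_im] at hsq
    linarith
  rw [Complex.div_natCast_re] at hre
  have hn' : (n : ℝ) ≠ 0 := by exact_mod_cast hn
  simpa [hn'] using hre

/-! ### The differential of `exp` through commutators -/

/-- The commutator with `X` as a bounded operator. -/
noncomputable def adCLM {M : Type*} [CStarAlgebra M] (X : M) : M →L[ℂ] M :=
  ContinuousLinearMap.mul ℂ M X - (ContinuousLinearMap.mul ℂ M).flip X

@[simp]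
theorem adCLM_apply {M : Type*} [CStarAlgebra M] (X y : M) : adCLM X y = X * y - y * X := rfl

theorem exp_mulLeft_apply {M : Type*} [CStarAlgebra M] (X y : M) :
    NormedSpace.exp (ContinuousLinearMap.mul ℂ M X) y = NormedSpace.exp X * y := by
  have h1 := (NormedSpace.exp_series_hasSum_exp' (𝕂 := ℂ)
    (ContinuousLinearMap.mul ℂ M X)).mapL (ContinuousLinearMap.apply ℂ M y)
  have h2 := (NormedSpace.exp_series_hasSum_exp' (𝕂 := ℂ) X).mul_right y
  refine h1.unique (h2.congr_fun fun n => ?_)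
  have : ∀ n, ((ContinuousLinearMap.mul ℂ M X) ^ n) y = X ^ n * y := by
    intro n
    induction n with
    | zero => simp
    | succ n ih => rw [pow_succ', mul_apply_eq_comp, ih]; simp [pow_succ', mul_assoc]
  simp [this]

theorem exp_mulRight_apply {M : Type*} [CStarAlgebra M] (X y : M) :
    NormedSpace.exp ((ContinuousLinearMap.mul ℂ M).flip X) y = y * NormedSpace.exp X := by
  have h1 := (NormedSpace.exp_series_hasSum_exp' (𝕂 := ℂ)
    ((ContinuousLinearMap.mul ℂ M).flip X)).mapL (ContinuousLinearMap.apply ℂ M y)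
  have h2 := (NormedSpace.exp_series_hasSum_exp' (𝕂 := ℂ) X).mul_left y
  refine h1.unique (h2.congr_fun fun n => ?_)
  have : ∀ n, (((ContinuousLinearMap.mul ℂ M).flip X) ^ n) y = y * X ^ n := by
    intro n
    induction n with
    | zero => simp
    | succ n ih => rw [pow_succ', mul_apply_eq_comp, ih]; simp [pow_succ, mul_assoc]
  simp [this]

theorem exp_adCLM_apply {M : Type*} [CStarAlgebra M] (X y : M) :
    NormedSpace.exp (adCLM X) y = NormedSpace.exp X * y * NormedSpace.exp (-X) := by
  let _ : NormedAlgebra ℚ (M →L[ℂ] M) := NormedAlgebra.restrictScalars ℚ ℂ _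
  have hcomm : Commute (ContinuousLinearMap.mul ℂ M X)
      ((ContinuousLinearMap.mul ℂ M).flip (-X)) := by
    ext y
    simp [mul_assoc]
  have : adCLM X = ContinuousLinearMap.mul ℂ M X + (ContinuousLinearMap.mul ℂ M).flip (-X) := by
    ext y
    simp [sub_eq_add_neg]
  rw [this, NormedSpace.exp_add_of_commute hcomm, mul_apply_eq_comp,
    exp_mulRight_apply, exp_mulLeft_apply, mul_assoc]

theorem continuous_exp_smul_mul_mul_exp_smul {M : Type*} [CStarAlgebra M] (X Y Z : M) :
    Continuous fun p : ℝ × ℝ => NormedSpace.exp (p.2 • (X + p.1 • Y)) * Y *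
      NormedSpace.exp ((1 - p.2) • Z) := by
  let _ : NormedAlgebra ℚ M := NormedAlgebra.restrictScalars ℚ ℂ M
  have := NormedSpace.exp_continuous (𝔸 := M)
  fun_prop

/-- Duhamel's formula. -/
theorem exp_sub_exp_eq_integral {M : Type*} [CStarAlgebra M] (A B : M) :
    NormedSpace.exp A - NormedSpace.exp B =
      ∫ s in (0 : ℝ)..1, NormedSpace.exp (s • A) * (A - B) * NormedSpace.exp ((1 - s) • B) := by
  let _ : NormedAlgebra ℚ M := NormedAlgebra.restrictScalars ℚ ℂ M
  have hexp := NormedSpace.exp_continuous (𝔸 := M)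
  have hderiv : ∀ s : ℝ, HasDerivAt
      (fun s : ℝ => NormedSpace.exp (s • A) * NormedSpace.exp ((1 - s) • B))
      (NormedSpace.exp (s • A) * (A - B) * NormedSpace.exp ((1 - s) • B)) s := by
    intro s
    have h1 := hasDerivAt_exp_smul_const (𝕂 := ℝ) A s
    have h2 := (hasDerivAt_exp_smul_const' (𝕂 := ℝ) B (1 - s)).scomp s
      ((hasDerivAt_id s).const_sub 1)
    refine (h1.mul h2).congr_deriv ?_
    simp [mul_add, add_mul, mul_assoc, sub_eq_add_neg]
  have := intervalIntegral.integral_eq_sub_of_hasDerivAt (a := 0) (b := 1)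
    (fun s _ => hderiv s) (Continuous.intervalIntegrable (by fun_prop) _ _)
  rw [this]
  simp

/-- Duhamel's formula for `X + tY` and `X` writes the difference quotient as an integral continuous
in `t`, including at `t = 0`. -/
theorem dexp_eq_integral {M : Type*} [CStarAlgebra M] (X Y : M) :
    dexp X Y = ∫ s in (0 : ℝ)..1,
      NormedSpace.exp (s • X) * Y * NormedSpace.exp ((1 - s) • X) := by
  have hline : HasDerivAt (fun t : ℝ => X + t • Y) Y 0 := by
    simpa using ((hasDerivAt_id (0 : ℝ)).smul_const Y).const_add X
  have hf : HasDerivAt (fun t : ℝ => NormedSpace.exp (X + t • Y)) (dexp X Y) 0 := by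
    have h0 : HasFDerivAt (NormedSpace.exp : M → M) ((dexp X).restrictScalars ℝ)
        (X + (0 : ℝ) • Y) := by
      simpa using (hasFDerivAt_dexp X).restrictScalars ℝ
    exact h0.comp_hasDerivAt (0 : ℝ) hline
  have hlim := hf.tendsto_slope_zero
  have hcont := intervalIntegral.continuous_parametric_intervalIntegral_of_continuous'
    (μ := MeasureTheory.volume)
    (f := fun t s : ℝ => NormedSpace.exp (s • (X + t • Y)) * Y * NormedSpace.exp ((1 - s) • X))
    (continuous_exp_smul_mul_mul_exp_smul X Y X) 0 1
  have hlim2 := (hcont.tendsto 0).mono_left (nhdsWithin_le_nhds (s := {(0 : ℝ)}ᶜ))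
  simp only [zero_smul, add_zero] at hlim2
  refine tendsto_nhds_unique (hlim.congr' ?_) hlim2
  filter_upwards [self_mem_nhdsWithin] with t ht
  have ht : t ≠ 0 := ht
  rw [zero_add, zero_smul, add_zero, exp_sub_exp_eq_integral, ← intervalIntegral.integral_smul]
  refine intervalIntegral.integral_congr fun s _ => ?_
  simp [smul_smul, ht]

theorem exp_neg_mul_dexp_mul_exp_neg {M : Type*} [CStarAlgebra M] (X Y : M) :
    NormedSpace.exp (-X) * dexp ((2 : ℝ) • X) Y * NormedSpace.exp (-X) =
      ∫ s in (0 : ℝ)..1, NormedSpace.exp ((2 * s - 1) • adCLM X) Y := by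
  let _ : NormedAlgebra ℚ M := NormedAlgebra.restrictScalars ℚ ℂ M
  have hexp := NormedSpace.exp_continuous (𝔸 := M)
  have hint : IntervalIntegrable (fun s : ℝ => NormedSpace.exp (s • (2 : ℝ) • X) * Y *
      NormedSpace.exp ((1 - s) • (2 : ℝ) • X)) MeasureTheory.volume 0 1 :=
    Continuous.intervalIntegrable (by fun_prop) _ _
  have h := ContinuousLinearMap.intervalIntegral_comp_comm
    (ContinuousLinearMap.mul ℂ M (NormedSpace.exp (-X)) ∘L
      (ContinuousLinearMap.mul ℂ M).flip (NormedSpace.exp (-X))) hint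
  rw [dexp_eq_integral, mul_assoc]
  refine Eq.trans h.symm (intervalIntegral.integral_congr fun s _ => ?_)
  have hadd : ∀ a b : ℝ, NormedSpace.exp (a • X) * NormedSpace.exp (b • X) =
      NormedSpace.exp ((a + b) • X) := by
    intro a b
    rw [add_smul, NormedSpace.exp_add_of_commute (((Commute.refl X).smul_left a).smul_right b)]
  have had : (2 * s - 1) • adCLM X = adCLM ((2 * s - 1) • X) := by
    ext y
    simp [smul_sub]
  have hn : -X = (-1 : ℝ) • X := by simp
  simp only [ContinuousLinearMap.comp_apply, ContinuousLinearMap.flip_apply,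
    ContinuousLinearMap.mul_apply']
  rw [had, exp_adCLM_apply, hn, smul_smul, smul_smul, mul_assoc, hadd, ← neg_smul]
  rw [show (1 - s) * 2 + -1 = -(2 * s - 1) by ring, ← mul_assoc, ← mul_assoc, hadd]
  rw [show -1 + s * 2 = 2 * s - 1 by ring]

/-! ### Power series of the averaged exponential, and convergence of the tails -/

theorem integral_two_mul_sub_one_pow (j : ℕ) :
    ((∫ s in (0 : ℝ)..1, (2 * s - 1) ^ j : ℝ) : ℂ) = evenCoeff j / (j + 1) := by
  have := intervalIntegral.integral_comp_mul_add (a := 0) (b := 1) (fun x : ℝ => x ^ j)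
    (two_ne_zero) (-1)
  simp only [← sub_eq_add_neg] at this
  rw [this, integral_pow]
  have hj : (j + 1 : ℂ) ≠ 0 := by exact_mod_cast Nat.succ_ne_zero j
  simp only [evenCoeff, smul_eq_mul]
  push_cast
  norm_num
  field_simp
  ring

theorem hasSum_integral_exp_smul_apply {E : Type*} [NormedAddCommGroup E] [NormedSpace ℂ E]
    [CompleteSpace E] (T : E →L[ℂ] E) (y : E) :
    HasSum (fun j : ℕ => (evenCoeff j / (j + 1).factorial) • (T ^ j) y)
      (∫ s in (0 : ℝ)..1, NormedSpace.exp ((2 * s - 1) • T) y) := by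
  let f : ℕ → C(ℝ, E) := fun j =>
    ⟨fun s => ((2 * s - 1) ^ j) • ((j.factorial : ℂ)⁻¹ • T ^ j) y, by fun_prop⟩
  have hsum : Summable fun j => ‖(f j).restrict
      (⟨Set.uIcc 0 1, isCompact_uIcc⟩ : TopologicalSpace.Compacts ℝ)‖ := by
    refine Summable.of_nonneg_of_le (fun _ => norm_nonneg _) (fun j => ?_)
      ((NormedSpace.norm_expSeries_summable' (𝕂 := ℂ) T).mul_right ‖y‖)
    rw [ContinuousMap.norm_le _ (by positivity)]
    rintro ⟨s, hs⟩
    have hs' : s ∈ Set.uIcc (0 : ℝ) 1 := hs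
    rw [Set.uIcc_of_le zero_le_one] at hs'
    have habs : |2 * s - 1| ≤ 1 := abs_le.mpr ⟨by linarith [hs'.1], by linarith [hs'.2]⟩
    simp only [ContinuousMap.restrict_apply, f, ContinuousMap.coe_mk]
    rw [norm_smul, norm_pow, Real.norm_eq_abs]
    calc |2 * s - 1| ^ j * ‖((j.factorial : ℂ)⁻¹ • T ^ j) y‖
        ≤ 1 * (‖(j.factorial : ℂ)⁻¹ • T ^ j‖ * ‖y‖) := by
          gcongr
          · exact pow_le_one₀ (abs_nonneg _) habs
          · exact ContinuousLinearMap.le_opNorm _ _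
      _ = _ := one_mul _
  have h := intervalIntegral.hasSum_intervalIntegral_of_summable_norm hsum
  have hexp : ∀ s : ℝ, ∑' j, f j s = NormedSpace.exp ((2 * s - 1) • T) y := by
    intro s
    have h1 := (NormedSpace.exp_series_hasSum_exp' (𝕂 := ℂ) ((2 * s - 1) • T)).mapL
      (ContinuousLinearMap.apply ℂ E y)
    refine HasSum.tsum_eq (h1.congr_fun fun j => ?_)
    simp only [f, ContinuousMap.coe_mk, smul_pow,
      ContinuousLinearMap.apply_apply, smul_apply]
    rw [smul_comm]
  simp only [hexp] at h
  refine h.congr_fun fun j => ?_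
  simp only [f, ContinuousMap.coe_mk]
  rw [intervalIntegral.integral_smul_const, ← Complex.coe_smul, integral_two_mul_sub_one_pow,
    smul_apply, smul_smul, Nat.factorial_succ]
  push_cast
  rw [← div_eq_mul_inv, div_div]

/-- Termwise, `n.choose k / n ^ k` tends to `1 / k!`; dominated convergence for series applies, with
the exponential series of `‖T‖` type as majorant. -/
theorem tendsto_aeval_sinhcTail {E : Type*} [NormedAddCommGroup E] [NormedSpace ℂ E]
    [CompleteSpace E] (T : E →L[ℂ] E) (y : E) :
    Filter.Tendsto (fun n => Polynomial.aeval T (sinhcTail n) y) Filter.atTop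
      (nhds (∑' j : ℕ, (evenCoeff (j + 1) / (j + 2).factorial) • (T ^ j) y)) := by
  have heq : ∀ n, Polynomial.aeval T (sinhcTail n) y =
      ∑' j : ℕ, (evenCoeff (j + 1) * (n.choose (j + 2) / n ^ (j + 2))) • (T ^ j) y := by
    intro n
    rw [tsum_eq_sum (s := Finset.range (n - 1))]
    · simp only [sinhcTail, map_sum, map_mul, Polynomial.aeval_C, map_pow, Polynomial.aeval_X,
        Algebra.algebraMap_eq_smul_one, smul_mul_assoc, one_mul, sum_apply, smul_apply, mul_smul]
    · intro j hj
      -- Outside the range `j + 2 > n`, also when `n = 0` and `n - 1` truncates to `0`.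
      rw [Finset.mem_range, not_lt] at hj
      rw [Nat.choose_eq_zero_of_lt (by omega)]
      simp
  simp only [heq]
  refine tendsto_tsum_of_dominated_convergence
    (bound := fun j => ‖(j.factorial : ℂ)⁻¹ • T ^ j‖ * ‖y‖)
    ((NormedSpace.norm_expSeries_summable' (𝕂 := ℂ) T).mul_right ‖y‖) (fun j => ?_)
    (Filter.Eventually.of_forall fun n j => ?_)
  · refine Filter.Tendsto.smul_const ?_ _
    rw [div_eq_mul_inv]
    refine Filter.Tendsto.const_mul _ ?_
    have h := ProbabilityTheory.tendsto_choose_mul_pow_atTop (p := fun n => (n : ℝ)⁻¹) (r := 1)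
      (j + 2) (tendsto_const_nhds.congr' (by
        filter_upwards [Filter.eventually_ne_atTop 0] with n hn
        rw [mul_inv_cancel₀ (by exact_mod_cast hn)]))
    have h' := (Complex.continuous_ofReal.tendsto _).comp h
    simpa [Function.comp_def, div_eq_mul_inv] using h'
  · rw [norm_smul, norm_mul]
    have hc : ‖((n.choose (j + 2) : ℂ) / (n : ℂ) ^ (j + 2))‖ ≤ (j.factorial : ℝ)⁻¹ := by
      rw [norm_div, norm_pow, Complex.norm_natCast, Complex.norm_natCast]
      refine div_le_of_le_mul₀ (by positivity) (by positivity) ?_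
      refine (Nat.choose_le_pow_div (j + 2) n).trans ?_
      rw [div_eq_inv_mul]
      gcongr
      omega
    calc ‖evenCoeff (j + 1)‖ * ‖((n.choose (j + 2) : ℂ) / (n : ℂ) ^ (j + 2))‖ * ‖(T ^ j) y‖
        ≤ 1 * (j.factorial : ℝ)⁻¹ * (‖T ^ j‖ * ‖y‖) := by
          gcongr
          · exact norm_evenCoeff_le _
          · exact ContinuousLinearMap.le_opNorm _ _
      _ = _ := by
          rw [norm_smul, norm_inv, Complex.norm_natCast]
          ring

theorem summable_evenCoeff_smul {E : Type*} [NormedAddCommGroup E] [NormedSpace ℂ E]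
    [CompleteSpace E] (T : E →L[ℂ] E) (y : E) :
    Summable fun j : ℕ => (evenCoeff (j + 1) / (j + 2).factorial) • (T ^ j) y := by
  refine Summable.of_norm_bounded
    ((NormedSpace.norm_expSeries_summable' (𝕂 := ℂ) T).mul_right ‖y‖) fun j => ?_
  rw [norm_smul, norm_div, norm_smul, norm_inv, Complex.norm_natCast, Complex.norm_natCast,
    div_eq_mul_inv]
  calc ‖evenCoeff (j + 1)‖ * ((j + 2).factorial : ℝ)⁻¹ * ‖(T ^ j) y‖
      ≤ 1 * (j.factorial : ℝ)⁻¹ * (‖T ^ j‖ * ‖y‖) := by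
        gcongr
        · exact norm_evenCoeff_le _
        · omega
        · exact ContinuousLinearMap.le_opNorm _ _
    _ = _ := by ring

/-- One factor `T` is kept outside the series: for `T = ad X` it is this factor that maps `M`
boundedly into the ideal. -/
theorem integral_exp_smul_apply {E : Type*} [NormedAddCommGroup E] [NormedSpace ℂ E]
    [CompleteSpace E] (T : E →L[ℂ] E) (y : E) :
    ∫ s in (0 : ℝ)..1, NormedSpace.exp ((2 * s - 1) • T) y =
      y + T (∑' j : ℕ, (evenCoeff (j + 1) / (j + 2).factorial) • (T ^ j) y) := by
  have h := hasSum_integral_exp_smul_apply T y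
  rw [← h.tsum_eq, h.summable.tsum_eq_zero_add, T.map_tsum (summable_evenCoeff_smul T y)]
  congr 1
  · simp [evenCoeff]
  · refine tsum_congr fun j => ?_
    rw [map_smul, pow_succ', mul_apply_eq_comp]

/-! ### Passage to the limit in the ideal norm -/

namespace NormedIdeal

variable {M : Type*} [CStarAlgebra M] (I : NormedIdeal M)

theorem coe_aeval_ad_apply (X : M) (p : Polynomial ℂ) (y : I.toSubmodule) :
    (Polynomial.aeval (I.ad X) p y : M) = Polynomial.aeval (adCLM X) p (y : M) := by
  have hpow : ∀ n, (((I.ad X) ^ n) y : M) = ((adCLM X) ^ n) (y : M) := by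
    intro n
    induction n with
    | zero => simp
    | succ n ih =>
      rw [pow_succ', pow_succ', Module.End.mul_apply, mul_apply_eq_comp, coe_ad_apply,
        ih, adCLM_apply]
  induction p using Polynomial.induction_on' with
  | add p q hp hq => simp [hp, hq]
  | monomial n a => simp [Polynomial.aeval_monomial, hpow, Algebra.algebraMap_eq_smul_one]

/-- If `X` lies in the ideal, then the commutator with `X` is bounded from the norm of the
algebra to the norm of the ideal. -/
theorem nrm_le_of_eq_commutator {X : M} (hX : X ∈ I.toSubmodule) (w : M) (v : I.toSubmodule)
    (hv : (v : M) = X * w - w * X) : I.nrm v ≤ 2 * I.nrm ⟨X, hX⟩ * ‖w‖ := by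
  have h1 : ‖(1 : M)‖ ≤ 1 := by
    cases subsingleton_or_nontrivial M
    · rw [Subsingleton.elim (1 : M) 0]; simp
    · simp
  have hN := apply_nonneg I.nrm ⟨X, hX⟩
  have ha := I.nrm_mul_mul_le' 1 w ⟨X, hX⟩ ⟨X * w, I.mul_mem_right w hX⟩ (by simp)
  have hb := I.nrm_mul_mul_le' w 1 ⟨X, hX⟩ ⟨w * X, I.mul_mem_left w hX⟩ (by simp)
  have hab : v = ⟨X * w, I.mul_mem_right w hX⟩ - ⟨w * X, I.mul_mem_left w hX⟩ := Subtype.ext hv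
  rw [hab]
  refine (map_sub_le_add _ _ _).trans ((add_le_add ha hb).trans ?_)
  have := mul_le_mul_of_nonneg_right h1 (mul_nonneg hN (norm_nonneg w))
  linarith

theorem nrm_le_nrm_exp_neg_mul_dexp_mul_exp_neg {X : M} (hXsa : IsSelfAdjoint X)
    (hX : X ∈ I.toSubmodule) (y : I.toSubmodule) :
    ∃ h : NormedSpace.exp (-X) * dexp ((2 : ℝ) • X) y * NormedSpace.exp (-X) ∈ I.toSubmodule,
      I.nrm y ≤ I.nrm ⟨_, h⟩ := by
  set Q : M := ∑' j : ℕ, (evenCoeff (j + 1) / (j + 2).factorial) • ((adCLM X) ^ j) (y : M)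
  have hZ : NormedSpace.exp (-X) * dexp ((2 : ℝ) • X) y * NormedSpace.exp (-X) =
      y + (X * Q - Q * X) := by
    rw [exp_neg_mul_dexp_mul_exp_neg, integral_exp_smul_apply]
    rfl
  have hQ : X * Q - Q * X ∈ I.toSubmodule :=
    sub_mem (I.mul_mem_right Q hX) (I.mul_mem_left Q hX)
  have hmem := add_mem y.2 hQ
  simp only [hZ]
  refine ⟨hmem, ?_⟩
  -- These numbers bound `I.nrm y` from above for `n ≠ 0`: each is the norm of the target plus a
  -- bound for its ideal-norm distance to the `n`-th approximant.
  have hlim : Filter.Tendsto (fun n => I.nrm ⟨_, hmem⟩ + 2 * I.nrm ⟨X, hX⟩ *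
      ‖Polynomial.aeval (adCLM X) (sinhcTail n) (y : M) - Q‖) Filter.atTop
      (nhds (I.nrm ⟨_, hmem⟩ + 2 * I.nrm ⟨X, hX⟩ * 0)) :=
    ((tendsto_iff_norm_sub_tendsto_zero.mp
      (tendsto_aeval_sinhcTail (adCLM X) (y : M))).const_mul _).const_add _
  rw [mul_zero, add_zero] at hlim
  refine ge_of_tendsto hlim ?_
  filter_upwards [Filter.eventually_ne_atTop 0] with n hn
  have h1 := I.nrm.le_aeval_apply (I.ad X) (I.nrm_le_add_smul_ad hXsa)
    (1 + Polynomial.X * sinhcTail n) (by simp) (re_eq_zero_of_eval_sinhcTail hn) y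
  refine h1.trans ?_
  set u := Polynomial.aeval (I.ad X) (1 + Polynomial.X * sinhcTail n) y with hu
  have hdiff := I.nrm_le_of_eq_commutator hX
    (Polynomial.aeval (adCLM X) (sinhcTail n) (y : M) - Q) (u - ⟨_, hmem⟩) (by
      rw [AddSubgroupClass.coe_sub, hu, map_add, map_one, map_mul, Polynomial.aeval_X,
        LinearMap.add_apply, Module.End.one_apply, Module.End.mul_apply, Submodule.coe_add,
        coe_ad_apply, coe_aeval_ad_apply]
      noncomm_ring)
  have := map_add_le_add I.nrm ⟨_, hmem⟩ (u - ⟨_, hmem⟩)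
  rw [add_sub_cancel] at this
  linarith

end NormedIdeal

theorem mainTheorem8 {M : Type*} [CStarAlgebra M] (I : NormedIdeal M) (X Y : M)
    (hXsa : IsSelfAdjoint X) (hYsa : IsSelfAdjoint Y)
    (hX : X ∈ I.toSubmodule) (hY : Y ∈ I.toSubmodule) :
    ∃ h : NormedSpace.exp (-((1 / 2 : ℂ) • X)) * dexp X Y * NormedSpace.exp (-((1 / 2 : ℂ) • X))
        ∈ I.toSubmodule,
      ‖I.emb Y hY‖ ≤
        ‖I.emb (NormedSpace.exp (-((1 / 2 : ℂ) • X)) * dexp X Y *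
          NormedSpace.exp (-((1 / 2 : ℂ) • X))) h‖ := by
  have hhalf : (2 : ℝ) • (1 / 2 : ℂ) • X = X := by
    rw [← Complex.coe_smul, smul_smul]
    norm_num
  have hsa : IsSelfAdjoint ((1 / 2 : ℂ) • X) := by
    rw [IsSelfAdjoint, star_smul, hXsa.star_eq]
    simp
  obtain ⟨h, hle⟩ := I.nrm_le_nrm_exp_neg_mul_dexp_mul_exp_neg hsa
    (I.toSubmodule.smul_mem _ hX) ⟨Y, hY⟩
  simp only [hhalf] at h hle
  refine ⟨h, ?_⟩
  rw [I.norm_emb, I.norm_emb]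
  exact hle
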